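/- A \emph{range min-max encoding} for a class $\mathcal{A}$ of real arrays $A[1..n]$ assigns to every $A\in\mathcal{A}$ a bit string such that, for all $1\le i\le j\le n$, an index of a maximum and an index of a minimum of $A$ over $[i,j]$ can be determined from that bit string (together with $n$, $i$, $j$) alone, without access to $A$. It occupies at most $m$ bits if all these strings have length at most $m$. \textbf{Theorem.} Any range min-max encoding must occupy $3n-\Theta(\log n)$ bits for sufficiently large $n$. That is, there are constants $c,C>0$ and $N$ such that for all $n\ge N$: (i) for every class $\mathcal{A}$ of arrays of length $n$ that contains all permutations of $1,\dots,n$, every range min-max encoding for $\mathcal{A}$ that occupies at most $m$ bits satisfies $m\ge 3n-C\log_2 n$; and (ii) for some $m\le 3n-c\log_2 n$ there is a range min-max encoding that handles all real arrays of length $n$ and occupies at most $m$ bits. -/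

import Mathlib

/-- `l` answers the range maximum query `[i, j]` on the array `A`: it is an index in `[i, j]` at
which `A` attains its maximum over `[i, j]`. Among equal values every such index is accepted. -/
def IsRangeMax {n : ℕ} (A : Fin n → ℝ) (i j l : Fin n) : Prop :=
  l ∈ Set.Icc i j ∧ IsMaxOn A (Set.Icc i j) l

/-- `l` answers the range minimum query `[i, j]` on the array `A`. -/
def IsRangeMin {n : ℕ} (A : Fin n → ℝ) (i j l : Fin n) : Prop :=
  l ∈ Set.Icc i j ∧ IsMinOn A (Set.Icc i j) l

/-- The arrays of length `n` whose entries form a permutation of `1, …, n`. -/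
def permArrays (n : ℕ) : Set (Fin n → ℝ) :=
  {A | ∃ σ : Equiv.Perm (Fin n), ∀ k, A k = ((σ k : ℕ) : ℝ) + 1}

/-- An encoding of simultaneous range minimum and maximum queries, for input arrays from the
class `𝒜` of arrays of length `n`, that occupies at most `m` bits. An array is mapped to a bit
string, and every query is answered from the bit string alone (and `n`), without access to the
array. The bit strings may have different lengths; the space is the worst case over `𝒜`. -/
structure RangeMinMaxEncoding (n : ℕ) (𝒜 : Set (Fin n → ℝ)) (m : ℕ) where
  /-- the bit string stored for an array -/
  encode : (Fin n → ℝ) → List Bool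
  /-- the pair (index of a maximum, index of a minimum) returned for the query `[i, j]` -/
  query : List Bool → Fin n → Fin n → Fin n × Fin n
  length_le : ∀ A ∈ 𝒜, (encode A).length ≤ m
  correct : ∀ A ∈ 𝒜, ∀ i j : Fin n, i ≤ j →
    IsRangeMax A i j (query (encode A) i j).1 ∧ IsRangeMin A i j (query (encode A) i j).2

/-!
Scan an array from left to right with two stacks: one holds the positions whose value exceeds all
later values seen so far, the other those whose value is at most all later values. A new value
pushes onto both stacks, and it pops at least the top of exactly one of them, according to whether
it is at least or smaller than its predecessor. If `(a, b)` are the numbers of positions below the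
common top, one step thus leads to `(a + 1, i)` with `i ≤ b` or to `(j, b + 1)` with `j ≤ a`
(`stackSizes_succ_mem`), which is the generating tree of the Baxter permutations.

The walk of stack sizes determines the stacks (`stacks_eq_of_stackSizes_eq`), and the stacks
determine an answer to every query: the last maximum over `[i, j]` is the first position `≥ i` on
the stack at time `j`. Conversely the answers for a permutation determine its stacks
(`stackSizes_eq_of_answers`), and every walk comes from a permutation, since the next value can be
chosen in any gap between the values on a stack (`exists_array_extending`). Hence the optimal number
of bits is, up to one bit, the logarithm of the number of walks with `n - 1` steps from `(0, 0)`
(`nonempty_rangeMinMaxEncoding`, `card_walks_lt_of_encoding`).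

It remains to bound the number of walks. Remembering only the direction of each step and the sum
`a + b` gives at most `2 ^ n * centralBinom n ≤ 8 ^ n / √(2 n + 1)` walks with `n` steps
(`card_walks_sq_mul_le`). In the other direction, the walks with `k` steps of the second kind and
`l` steps of the first kind are encoded by triples of nonintersecting lattice paths, and the
corresponding `3 × 3` determinant of binomial coefficients (Lindström–Gessel–Viennot) satisfies the
recursion of the number of walks. Only the inequality `det₃_le_card_walks` is needed; for `k = l`
the determinant is `8 ^ (2 k)` up to a polynomial factor (`det₃_central`).
-/

/-! ### Walks in the generating tree -/

open Finset in
/-- The states reachable in one step from `(a, b)`: `(a + 1, i)` with `i ≤ b` and `(j, b + 1)` with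
`j ≤ a`. This is the generating tree of the Baxter permutations. -/
def nextStates (s : ℕ × ℕ) : Finset (ℕ × ℕ) :=
  (range (s.2 + 1)).image (fun i => (s.1 + 1, i)) ∪ (range (s.1 + 1)).image (fun j => (j, s.2 + 1))

theorem mem_nextStates {s t : ℕ × ℕ} :
    t ∈ nextStates s ↔ (t.1 = s.1 + 1 ∧ t.2 ≤ s.2) ∨ (t.1 ≤ s.1 ∧ t.2 = s.2 + 1) := by
  obtain ⟨a, b⟩ := s
  obtain ⟨c, d⟩ := t
  simp only [nextStates, Finset.mem_union, Finset.mem_image, Finset.mem_range, Prod.mk.injEq]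
  constructor
  · rintro (⟨i, hi, rfl, rfl⟩ | ⟨j, hj, rfl, rfl⟩)
    · exact Or.inl ⟨rfl, by omega⟩
    · exact Or.inr ⟨by omega, rfl⟩
  · rintro (⟨h1, h2⟩ | ⟨h1, h2⟩)
    · exact Or.inl ⟨d, by omega, h1.symm, rfl⟩
    · exact Or.inr ⟨c, by omega, rfl, h2.symm⟩

theorem sum_nextStates {M : Type*} [AddCommMonoid M] (a b : ℕ) (g : ℕ × ℕ → M) :
    ∑ t ∈ nextStates (a, b), g t =
      ∑ i ∈ Finset.range (b + 1), g (a + 1, i) + ∑ j ∈ Finset.range (a + 1), g (j, b + 1) := by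
  rw [nextStates, Finset.sum_union, Finset.sum_image, Finset.sum_image]
  · intro x _ y _ h
    exact (Prod.mk.inj h).1
  · intro x _ y _ h
    exact (Prod.mk.inj h).2
  · rw [Finset.disjoint_left]
    intro t h1 h2
    simp only [Finset.mem_image, Finset.mem_range] at h1 h2
    obtain ⟨i, _, rfl⟩ := h1
    obtain ⟨j, hj, h⟩ := h2
    have := (Prod.mk.inj h).1
    omega

/-- The walks of `n` steps from the state `s`, each given by the list of the states visited
after `s`. -/
def walks : ℕ → ℕ × ℕ → Finset (List (ℕ × ℕ))
  | 0, _ => {[]}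
  | n + 1, s => (nextStates s).biUnion fun t => (walks n t).image (List.cons t)

theorem card_walks_succ (n a b : ℕ) :
    (walks (n + 1) (a, b)).card = ∑ i ∈ Finset.range (b + 1), (walks n (a + 1, i)).card +
      ∑ j ∈ Finset.range (a + 1), (walks n (j, b + 1)).card := by
  rw [walks, Finset.card_biUnion, ← sum_nextStates a b fun t => (walks n t).card]
  · refine Finset.sum_congr rfl fun t _ => Finset.card_image_of_injective _ ?_
    exact List.cons_injective
  · intro s _ t _ hst
    rw [Function.onFun, Finset.disjoint_left]
    intro l h1 h2
    simp only [Finset.mem_image] at h1 h2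
    obtain ⟨p, _, rfl⟩ := h1
    obtain ⟨q, _, h⟩ := h2
    exact hst (List.cons.inj h).1.symm

theorem card_walks_le_succ (n : ℕ) (a b : ℕ) :
    (walks n (a, b)).card ≤ (walks (n + 1) (a, b)).card := by
  induction n generalizing a b with
  | zero =>
    rw [card_walks_succ]
    simp [walks]
    omega
  | succ n ih =>
    rw [card_walks_succ, card_walks_succ (n + 1)]
    exact add_le_add (Finset.sum_le_sum fun _ _ => ih _ _) (Finset.sum_le_sum fun _ _ => ih _ _)

/-! ### An upper bound for the number of walks -/

/-- The hockey-stick identity with its boundary term dropped. -/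
theorem sum_choose_shift_le (n a b : ℕ) :
    ∑ i ∈ Finset.range (b + 1), (2 * n + (a + 1 + i)).choose n ≤
      (2 * (n + 1) + (a + b)).choose (n + 1) := by
  induction b with
  | zero =>
    have h := Nat.choose_succ_succ (2 * n + (a + 1)) n
    rw [show 2 * (n + 1) + (a + 0) = 2 * n + (a + 1) + 1 by ring]
    simp only [zero_add, Finset.range_one, Finset.sum_singleton, add_zero]
    simp only [Nat.succ_eq_add_one] at h
    omega
  | succ b ih =>
    rw [Finset.sum_range_succ,
      show 2 * (n + 1) + (a + (b + 1)) = (2 * (n + 1) + (a + b)) + 1 by ring,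
      Nat.choose_succ_succ (2 * (n + 1) + (a + b)) n,
      show 2 * n + (a + 1 + (b + 1)) = 2 * (n + 1) + (a + b) by ring]
    simp only [Nat.succ_eq_add_one]
    omega

/-- Only the direction of each step and the sum of the two coordinates are remembered here; the
sum can change in one step from `s` to any of at most `s + 1` values, for each direction. -/
theorem card_walks_le (n a b : ℕ) :
    (walks n (a, b)).card ≤ 2 ^ n * (2 * n + (a + b)).choose n := by
  induction n generalizing a b with
  | zero => simp [walks]
  | succ n ih =>
    have h1 := sum_choose_shift_le n a b
    have h2 := sum_choose_shift_le n b a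
    rw [card_walks_succ]
    calc _ ≤ ∑ i ∈ Finset.range (b + 1), 2 ^ n * (2 * n + (a + 1 + i)).choose n +
          ∑ j ∈ Finset.range (a + 1), 2 ^ n * (2 * n + (b + 1 + j)).choose n := by
          gcongr with i _ j _
          · exact ih _ _
          · exact (ih _ _).trans_eq (by rw [add_comm j])
      _ ≤ _ := by
          rw [← Finset.mul_sum, ← Finset.mul_sum, pow_succ]
          rw [add_comm b a] at h2
          nlinarith [pow_pos (two_pos : (0 : ℕ) < 2) n]

theorem centralBinom_sq_mul_le (n : ℕ) : n.centralBinom ^ 2 * (2 * n + 1) ≤ 16 ^ n := by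
  induction n with
  | zero => simp
  | succ n ih =>
    have h := Nat.succ_mul_centralBinom_succ n
    have h3 : (n + 1) ^ 2 * ((n + 1).centralBinom ^ 2 * (2 * (n + 1) + 1)) ≤
        (n + 1) ^ 2 * 16 ^ (n + 1) := by
      calc _ = ((n + 1) * (n + 1).centralBinom) ^ 2 * (2 * n + 3) := by ring
        _ = (n.centralBinom ^ 2 * (2 * n + 1)) * (4 * ((2 * n + 1) * (2 * n + 3))) := by
          rw [h]; ring
        _ ≤ 16 ^ n * (4 * (4 * (n + 1) ^ 2)) :=
          Nat.mul_le_mul ih (Nat.mul_le_mul_left 4 (by nlinarith))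
        _ = _ := by ring
    exact Nat.le_of_mul_le_mul_left h3 (by positivity)

theorem card_walks_sq_mul_le (n : ℕ) : (walks n (0, 0)).card ^ 2 * (2 * n + 1) ≤ 64 ^ n := by
  have h := card_walks_le n 0 0
  calc _ ≤ (2 ^ n * n.centralBinom) ^ 2 * (2 * n + 1) := by
          gcongr
          simpa [Nat.centralBinom] using h
    _ = 4 ^ n * (n.centralBinom ^ 2 * (2 * n + 1)) := by
      rw [mul_pow, ← pow_mul, mul_comm n 2, pow_mul]; norm_num [mul_assoc]
    _ ≤ 4 ^ n * 16 ^ n := by gcongr; exact centralBinom_sq_mul_le n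
    _ = 64 ^ n := by rw [← mul_pow]; norm_num

/-! ### A lower bound for the number of walks -/

/-- The numbers of lattice paths with steps `(1, 0)` and `(0, 1)` from `(1, -(a + 1))` to the three
points `(k + 1, l - 1)`, `(k, l)`, `(k - 1, l + 1)`, where `L = l + a`. -/
def lowerRow (k L : ℕ) : Fin 3 → ℤ :=
  ![(k + L).choose L, (k + L).choose (L + 1), (k + L).choose (L + 2)]

/-- The numbers of lattice paths from `(0, 0)` to the same three points. The entries are written so
that no subtraction occurs. -/
def middleRow (k l : ℕ) : Fin 3 → ℤ :=
  ![(k + l).choose (k + 1), (k + l).choose k, (k + l).choose (l + 1)]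

/-- The numbers of lattice paths from `(-(b + 1), 1)` to the same three points, where
`K = k + b`. -/
def upperRow (l K : ℕ) : Fin 3 → ℤ :=
  ![(l + K).choose (K + 2), (l + K).choose (K + 1), (l + K).choose K]

/-- The determinant of the matrix with rows `u`, `v`, `w`. -/
def det₃ (u v w : Fin 3 → ℤ) : ℤ :=
  Matrix.det !![u 0, u 1, u 2; v 0, v 1, v 2; w 0, w 1, w 2]

theorem det₃_add_left (u u' v w : Fin 3 → ℤ) :
    det₃ (u + u') v w = det₃ u v w + det₃ u' v w := by
  simp only [det₃, Matrix.det_fin_three]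
  simp
  ring

theorem det₃_add_middle (u v v' w : Fin 3 → ℤ) :
    det₃ u (v + v') w = det₃ u v w + det₃ u v' w := by
  simp only [det₃, Matrix.det_fin_three]
  simp
  ring

theorem det₃_add_right (u v w w' : Fin 3 → ℤ) :
    det₃ u v (w + w') = det₃ u v w + det₃ u v w' := by
  simp only [det₃, Matrix.det_fin_three]
  simp
  ring

theorem det₃_left_eq_middle (u w : Fin 3 → ℤ) : det₃ u u w = 0 := by
  simp only [det₃, Matrix.det_fin_three]
  simp
  ring

theorem det₃_right_eq_middle (u w : Fin 3 → ℤ) : det₃ u w w = 0 := by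
  simp only [det₃, Matrix.det_fin_three]
  simp
  ring

theorem lowerRow_succ_succ (k L : ℕ) :
    lowerRow (k + 1) (L + 1) = lowerRow (k + 1) L + lowerRow k (L + 1) := by
  have h (c : ℕ) : (k + 1 + (L + 1)).choose (L + 1 + c) =
      (k + 1 + L).choose (L + c) + (k + (L + 1)).choose (L + 1 + c) := by
    rw [show k + 1 + (L + 1) = k + 1 + L + 1 by ring, show L + 1 + c = L + c + 1 by ring,
      Nat.choose_succ_succ, show k + (L + 1) = k + 1 + L by ring]
  have h0 := h 0
  have h1 := h 1
  have h2 := h 2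
  ext i
  fin_cases i
  · simpa [lowerRow] using mod_cast h0
  · simpa [lowerRow] using mod_cast h1
  · simpa [lowerRow] using mod_cast h2

theorem lowerRow_succ (k l : ℕ) : lowerRow (k + 1) l = lowerRow k l + middleRow k l := by
  have hs : (k + l).choose k = (k + l).choose l := Nat.choose_symm_add
  ext i
  fin_cases i
  · simp only [lowerRow, middleRow, Pi.add_apply, Fin.zero_eta, Matrix.cons_val_zero]
    have h := Nat.choose_succ_succ (k + l) k
    rw [show k + 1 + l = k + l + 1 by ring]
    have h' : (k + l + 1).choose l = (k + l + 1).choose (k + 1) :=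
      Nat.choose_symm_of_eq_add (by ring)
    simp only [Nat.succ_eq_add_one] at h
    push_cast [h', h, hs]
    ring
  · simp [lowerRow, middleRow, show k + 1 + l = k + l + 1 by ring, Nat.choose_succ_succ, hs]
    ring
  · simp [lowerRow, middleRow, show k + 1 + l = k + l + 1 by ring, Nat.choose_succ_succ]
    ring

theorem upperRow_eq (l K : ℕ) : upperRow l K = lowerRow l K ∘ Fin.rev := by
  ext i
  fin_cases i <;> simp [upperRow, lowerRow, Fin.rev]

theorem middleRow_comm (k l : ℕ) : middleRow k l = middleRow l k ∘ Fin.rev := by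
  have hs : (k + l).choose k = (k + l).choose l := Nat.choose_symm_add
  ext i
  fin_cases i <;> simp [middleRow, Fin.rev, add_comm l k, hs]

theorem upperRow_succ_succ (l K : ℕ) :
    upperRow (l + 1) (K + 1) = upperRow (l + 1) K + upperRow l (K + 1) := by
  simp only [upperRow_eq, lowerRow_succ_succ]
  rfl

theorem upperRow_succ (k l : ℕ) : upperRow (l + 1) k = upperRow l k + middleRow k l := by
  simp only [upperRow_eq, lowerRow_succ, middleRow_comm k l]
  rfl

theorem middleRow_succ_succ (k l : ℕ) :
    middleRow (k + 1) (l + 1) = middleRow k (l + 1) + middleRow (k + 1) l := by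
  ext i
  fin_cases i
  all_goals
    simp [middleRow, show k + 1 + (l + 1) = k + l + 1 + 1 by ring,
      show k + (l + 1) = k + l + 1 by ring, show k + 1 + l = k + l + 1 by ring]
  · rw [Nat.choose_succ_succ (k + l + 1) (k + 1)]; push_cast; ring
  · rw [Nat.choose_succ_succ (k + l + 1) k]; push_cast; ring
  · rw [Nat.choose_succ_succ (k + l + 1) (l + 1)]; push_cast; ring

/-- Summing over the starting points telescopes. The boundary term vanishes because there the lower
row equals the middle one. -/
theorem sum_det₃_lowerRow (k l a : ℕ) (w : Fin 3 → ℤ) :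
    ∑ j ∈ Finset.range (a + 1), det₃ (lowerRow k (l + j)) (middleRow k l) w =
      det₃ (lowerRow (k + 1) (l + a)) (middleRow k l) w := by
  induction a with
  | zero => simp [lowerRow_succ, det₃_add_left, det₃_left_eq_middle]
  | succ a ih =>
    rw [Finset.sum_range_succ, ih, ← add_assoc l a 1, lowerRow_succ_succ k (l + a),
      det₃_add_left]

theorem sum_det₃_upperRow (k l b : ℕ) (u : Fin 3 → ℤ) :
    ∑ i ∈ Finset.range (b + 1), det₃ u (middleRow k l) (upperRow l (k + i)) =
      det₃ u (middleRow k l) (upperRow (l + 1) (k + b)) := by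
  induction b with
  | zero => simp [upperRow_succ, det₃_add_right, det₃_right_eq_middle]
  | succ b ih =>
    rw [Finset.sum_range_succ, ih, ← add_assoc k b 1, upperRow_succ_succ l (k + b),
      det₃_add_right]

theorem lowerRow_zero_left (L : ℕ) : lowerRow 0 L = ![1, 0, 0] := by
  simp [lowerRow, Nat.choose_eq_zero_of_lt (show L < L + 2 by omega)]

theorem upperRow_zero_left (K : ℕ) : upperRow 0 K = ![0, 0, 1] := by
  simp [upperRow, Nat.choose_eq_zero_of_lt (show K < K + 2 by omega)]

theorem middleRow_zero_left (l : ℕ) : middleRow 0 l = ![(l : ℤ), 1, 0] := by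
  simp [middleRow]

theorem middleRow_zero_right (k : ℕ) : middleRow k 0 = ![0, 1, (k : ℤ)] := by
  simp [middleRow]

/-- The determinant satisfies the recursion of the number of walks with `k` steps `(j, b + 1)` and
`l` steps `(a + 1, i)`: by Pascal's rule the middle row splits into the middle rows after a step of
either kind, and the outer rows split by telescoping. -/
theorem det₃_le_card_walks (n k l a b : ℕ) (h : k + l = n) :
    det₃ (lowerRow k (l + a)) (middleRow k l) (upperRow l (k + b)) ≤ (walks n (a, b)).card := by
  induction n generalizing k l a b with
  | zero =>
    obtain ⟨rfl, rfl⟩ : k = 0 ∧ l = 0 := by omega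
    simp [walks, det₃, lowerRow, middleRow, upperRow, Matrix.det_fin_three,
      Nat.choose_eq_zero_of_lt (show a < a + 2 by omega)]
  | succ n ih =>
    have hR (l' : ℕ) (hl : k + l' = n) (hl' : l = l' + 1) :
        det₃ (lowerRow k (l + a)) (middleRow k l') (upperRow l (k + b)) ≤
          ∑ i ∈ Finset.range (b + 1), ((walks n (a + 1, i)).card : ℤ) := by
      subst hl'
      rw [← sum_det₃_upperRow]
      refine Finset.sum_le_sum fun i _ => ?_
      rw [show l' + 1 + a = l' + (a + 1) by ring]
      exact ih k l' (a + 1) i hl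
    have hL (k' : ℕ) (hk : k' + l = n) (hk' : k = k' + 1) :
        det₃ (lowerRow k (l + a)) (middleRow k' l) (upperRow l (k + b)) ≤
          ∑ j ∈ Finset.range (a + 1), ((walks n (j, b + 1)).card : ℤ) := by
      subst hk'
      rw [← sum_det₃_lowerRow]
      refine Finset.sum_le_sum fun j _ => ?_
      rw [show k' + 1 + b = k' + (b + 1) by ring]
      exact ih k' l j (b + 1) hk
    rw [card_walks_succ]
    push_cast
    rcases k with _ | k
    · obtain rfl : l = n + 0 + 1 := by omega
      have h0 : (0 : ℤ) ≤ ∑ j ∈ Finset.range (a + 1), ((walks n (j, b + 1)).card : ℤ) :=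
        Finset.sum_nonneg fun _ _ => Int.natCast_nonneg _
      refine le_trans (le_of_eq ?_) (le_add_of_le_of_nonneg (hR n (by omega) rfl) h0)
      rw [lowerRow_zero_left, add_zero, middleRow_zero_left, middleRow_zero_left]
      simp [det₃, Matrix.det_fin_three]
    · rcases l with _ | l
      · have h0 : (0 : ℤ) ≤ ∑ i ∈ Finset.range (b + 1), ((walks n (a + 1, i)).card : ℤ) :=
          Finset.sum_nonneg fun _ _ => Int.natCast_nonneg _
        refine le_trans (le_of_eq ?_) (le_add_of_nonneg_of_le h0 (hL k (by omega) rfl))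
        rw [upperRow_zero_left, middleRow_zero_right, middleRow_zero_right]
        simp [det₃, Matrix.det_fin_three]
      · rw [middleRow_succ_succ, det₃_add_middle, add_comm]
        exact add_le_add (hR l (by omega) rfl) (hL k (by omega) rfl)

theorem det₃_central (m : ℕ) :
    ((m : ℝ) + 1) ^ 3 * (m + 2) ^ 2 *
      (det₃ (lowerRow m (m + 0)) (middleRow m m) (upperRow m (m + 0)) : ℝ) =
      (4 * m + 2) ^ 2 * (m.centralBinom : ℝ) ^ 3 := by
  have h1 := Nat.choose_succ_right_eq (2 * m) m
  have h2 := Nat.choose_succ_right_eq (2 * m) (m + 1)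
  rw [show 2 * m - m = m by omega] at h1
  have h1' : ((2 * m).choose (m + 1) : ℝ) * (m + 1) = (2 * m).choose m * m := mod_cast h1
  have h2' : ((2 * m).choose (m + 2) : ℝ) * (m + 2) = (2 * m).choose (m + 1) * (m - 1) := by
    rcases m with _ | m
    · simp
    · rw [show 2 * (m + 1) - (m + 1 + 1) = m by omega] at h2
      have : ((2 * (m + 1)).choose (m + 1 + 2) : ℝ) * (m + 1 + 1 + 1) =
        (2 * (m + 1)).choose (m + 1 + 1) * m := mod_cast h2
      push_cast
      linear_combination this
  have hd : ((2 * m).choose (m + 1) : ℝ) = (2 * m).choose m * m / (m + 1) := by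
    field_simp; linear_combination h1'
  have he : ((2 * m).choose (m + 2) : ℝ) = (2 * m).choose (m + 1) * (m - 1) / (m + 2) := by
    field_simp; linear_combination h2'
  simp only [det₃, lowerRow, middleRow, upperRow, Matrix.det_fin_three, Nat.centralBinom,
    ← two_mul, add_zero]
  simp
  rw [he, hd]
  field_simp
  ring

theorem eight_pow_le_mul_card_walks {n : ℕ} (hn : 4 ≤ n) :
    8 ^ (n - 2) ≤ n ^ 8 * (walks (n - 1) (0, 0)).card := by
  obtain ⟨q, hq⟩ : ∃ q, n = 2 * q + 1 ∨ n = 2 * q + 2 := ⟨(n - 1) / 2, by omega⟩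
  have hmono : (walks (2 * q) (0, 0)).card ≤ (walks (n - 1) (0, 0)).card := by
    rcases hq with rfl | rfl
    · rfl
    · exact card_walks_le_succ _ _ _
  have hdet := det₃_le_card_walks (2 * q) q q 0 0 (by ring)
  have hc := det₃_central q
  have hb := Nat.four_pow_le_two_mul_self_mul_centralBinom q (by omega)
  have h64 : (64 : ℝ) ^ q ≤ (2 * q) ^ 3 * (q.centralBinom : ℝ) ^ 3 := by
    have : ((4 : ℝ) ^ q) ^ 3 ≤ (2 * q * q.centralBinom) ^ 3 := by
      gcongr
      exact_mod_cast hb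
    rw [← pow_mul, mul_comm q 3, pow_mul, mul_pow] at this
    norm_num at this ⊢
    exact this
  have hdet' : (det₃ (lowerRow q (q + 0)) (middleRow q q) (upperRow q (q + 0)) : ℝ) ≤
      (walks (2 * q) (0, 0)).card := mod_cast hdet
  have hqn : (2 * q : ℝ) ≤ n := by
    have : 2 * q ≤ n := by omega
    exact_mod_cast this
  have hqn1 : (q + 1 : ℝ) ≤ n := by
    have : q + 1 ≤ n := by omega
    exact_mod_cast this
  have hqn2 : (q + 2 : ℝ) ≤ n := by
    have : q + 2 ≤ n := by omega
    exact_mod_cast this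
  have main : (8 : ℝ) ^ (n - 2) ≤ n ^ 8 * (walks (n - 1) (0, 0)).card := by
    calc (8 : ℝ) ^ (n - 2) ≤ 8 ^ (2 * q) := pow_le_pow_right₀ (by norm_num) (by omega)
      _ = 64 ^ q := by rw [pow_mul]; norm_num
      _ ≤ (2 * q) ^ 3 * (q.centralBinom : ℝ) ^ 3 := h64
      _ ≤ (2 * q) ^ 3 * ((4 * q + 2) ^ 2 * (q.centralBinom : ℝ) ^ 3) := by
        gcongr
        apply le_mul_of_one_le_left (by positivity)
        nlinarith [(Nat.cast_nonneg q : (0 : ℝ) ≤ q)]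
      _ ≤ (2 * q) ^ 3 * (((q : ℝ) + 1) ^ 3 * (q + 2) ^ 2 * (walks (2 * q) (0, 0)).card) := by
        rw [← hc]
        gcongr
      _ ≤ n ^ 3 * ((n : ℝ) ^ 3 * n ^ 2 * (walks (n - 1) (0, 0)).card) := by
        gcongr
      _ = n ^ 8 * (walks (n - 1) (0, 0)).card := by ring
  exact_mod_cast main

/-! ### The stacks of an array -/

section Stacks

variable {α : Type*} [LinearOrder α]

/-- The positions below the top `k` of the first stack: those before `k` with a value larger than
all the later values up to `k`. -/
def rightMaxima (A : ℕ → α) (k : ℕ) : Finset ℕ :=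
  (Finset.range k).filter fun i => ∀ j ∈ Finset.Ioc i k, A j < A i

/-- The positions below the top `k` of the second stack: those before `k` whose value is at most
all the later values up to `k`. The inequality is weak, unlike in `rightMaxima`, so that at each
step exactly one of the two stacks has its top popped even if values are repeated. -/
def rightMinima (A : ℕ → α) (k : ℕ) : Finset ℕ :=
  (Finset.range k).filter fun i => ∀ j ∈ Finset.Ioc i k, A i ≤ A j

theorem mem_rightMaxima {A : ℕ → α} {k i : ℕ} :
    i ∈ rightMaxima A k ↔ i < k ∧ ∀ j, i < j → j ≤ k → A j < A i := by
  simp [rightMaxima]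

theorem mem_rightMinima {A : ℕ → α} {k i : ℕ} :
    i ∈ rightMinima A k ↔ i < k ∧ ∀ j, i < j → j ≤ k → A i ≤ A j := by
  simp [rightMinima]

theorem rightMaxima_succ (A : ℕ → α) (k : ℕ) :
    rightMaxima A (k + 1) = (insert k (rightMaxima A k)).filter fun i => A (k + 1) < A i := by
  ext i
  simp only [Finset.mem_filter, Finset.mem_insert, mem_rightMaxima]
  constructor
  · rintro ⟨h, h'⟩
    refine ⟨?_, h' _ (by omega) le_rfl⟩
    by_cases hi : i = k
    · exact Or.inl hi
    · exact Or.inr ⟨by omega, fun j h1 h2 => h' j h1 (by omega)⟩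
  · rintro ⟨h, h'⟩
    refine ⟨by omega, fun j h1 h2 => ?_⟩
    rcases Nat.lt_or_ge k j with hj | hj
    · obtain rfl : j = k + 1 := by omega
      exact h'
    · rcases h with rfl | h
      · omega
      · exact h.2 j h1 hj

theorem rightMinima_succ (A : ℕ → α) (k : ℕ) :
    rightMinima A (k + 1) = (insert k (rightMinima A k)).filter fun i => A i ≤ A (k + 1) := by
  ext i
  simp only [Finset.mem_filter, Finset.mem_insert, mem_rightMinima]
  constructor
  · rintro ⟨h, h'⟩
    refine ⟨?_, h' _ (by omega) le_rfl⟩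
    by_cases hi : i = k
    · exact Or.inl hi
    · exact Or.inr ⟨by omega, fun j h1 h2 => h' j h1 (by omega)⟩
  · rintro ⟨h, h'⟩
    refine ⟨by omega, fun j h1 h2 => ?_⟩
    rcases Nat.lt_or_ge k j with hj | hj
    · obtain rfl : j = k + 1 := by omega
      exact h'
    · rcases h with rfl | h
      · omega
      · exact h.2 j h1 hj

theorem notMem_rightMaxima (A : ℕ → α) (k : ℕ) : k ∉ rightMaxima A k := by
  simp [mem_rightMaxima]

theorem notMem_rightMinima (A : ℕ → α) (k : ℕ) : k ∉ rightMinima A k := by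
  simp [mem_rightMinima]

theorem strictAntiOn_rightMaxima (A : ℕ → α) (k : ℕ) :
    StrictAntiOn A (insert k (rightMaxima A k) : Finset ℕ) := by
  intro i hi j hj hij
  simp only [Finset.coe_insert, Set.mem_insert_iff, Finset.mem_coe, mem_rightMaxima] at hi hj
  rcases hi with rfl | hi
  · omega
  · exact hi.2 j hij (by omega)

theorem monotoneOn_rightMinima (A : ℕ → α) (k : ℕ) :
    MonotoneOn A (insert k (rightMinima A k) : Finset ℕ) := by
  intro i hi j hj hij
  rcases hij.eq_or_lt with rfl | hij
  · rfl
  simp only [Finset.coe_insert, Set.mem_insert_iff, Finset.mem_coe, mem_rightMinima] at hi hj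
  rcases hi with rfl | hi
  · omega
  · exact hi.2 j hij (by omega)

/-- The sizes of the two stacks below their common top `k`. -/
def stackSizes (A : ℕ → α) (k : ℕ) : ℕ × ℕ := ((rightMaxima A k).card, (rightMinima A k).card)

theorem rightMaxima_congr {A B : ℕ → α} {k : ℕ} (h : ∀ i ≤ k, A i = B i) :
    rightMaxima A k = rightMaxima B k := by
  ext i
  simp only [mem_rightMaxima]
  refine and_congr_right fun hi => forall_congr' fun j => forall_congr' fun _ => forall_congr'
    fun hj => ?_
  rw [h j hj, h i hi.le]

theorem rightMinima_congr {A B : ℕ → α} {k : ℕ} (h : ∀ i ≤ k, A i = B i) :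
    rightMinima A k = rightMinima B k := by
  ext i
  simp only [mem_rightMinima]
  refine and_congr_right fun hi => forall_congr' fun j => forall_congr' fun _ => forall_congr'
    fun hj => ?_
  rw [h j hj, h i hi.le]

theorem stackSizes_congr {A B : ℕ → α} {k : ℕ} (h : ∀ i ≤ k, A i = B i) :
    stackSizes A k = stackSizes B k := by
  rw [stackSizes, stackSizes, rightMaxima_congr h, rightMinima_congr h]

theorem stackSizes_zero (A : ℕ → α) : stackSizes A 0 = (0, 0) := by
  simp [stackSizes, rightMaxima, rightMinima]

theorem stackSizes_succ_mem (A : ℕ → α) (k : ℕ) :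
    stackSizes A (k + 1) ∈ nextStates (stackSizes A k) := by
  rw [mem_nextStates]
  simp only [stackSizes]
  have hmax := Finset.card_insert_of_notMem (notMem_rightMaxima A k)
  have hmin := Finset.card_insert_of_notMem (notMem_rightMinima A k)
  rcases lt_or_ge (A (k + 1)) (A k) with h | h
  · left
    constructor
    · rw [rightMaxima_succ, Finset.filter_true_of_mem, hmax]
      intro i hi
      rcases Finset.mem_insert.1 hi with rfl | hi
      · exact h
      · exact h.trans ((mem_rightMaxima.1 hi).2 k (mem_rightMaxima.1 hi).1 le_rfl)
    · rw [rightMinima_succ, Finset.filter_insert, if_neg h.not_ge]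
      exact Finset.card_filter_le _ _
  · right
    constructor
    · rw [rightMaxima_succ, Finset.filter_insert, if_neg h.not_gt]
      exact Finset.card_filter_le _ _
    · rw [rightMinima_succ, Finset.filter_true_of_mem, hmin]
      intro i hi
      rcases Finset.mem_insert.1 hi with rfl | hi
      · exact h
      · exact ((mem_rightMinima.1 hi).2 k (mem_rightMinima.1 hi).1 le_rfl).trans h

theorem map_stackSizes_mem_walks (A : ℕ → α) (k m : ℕ) :
    (List.range' (k + 1) m).map (stackSizes A) ∈ walks m (stackSizes A k) := by
  induction m generalizing k with
  | zero => simp [walks]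
  | succ m ih =>
    rw [List.range'_succ, List.map_cons, walks, Finset.mem_biUnion]
    exact ⟨_, stackSizes_succ_mem A k, Finset.mem_image_of_mem _ (ih (k + 1))⟩

/-- Initial segments of a finite set are determined by their size. -/
theorem filter_eq_filter_of_card_eq (s : Finset ℕ) (p q : ℕ → Prop) [DecidablePred p]
    [DecidablePred q] (hp : ∀ i ∈ s, ∀ j ∈ s, i < j → p j → p i)
    (hq : ∀ i ∈ s, ∀ j ∈ s, i < j → q j → q i) (h : (s.filter p).card = (s.filter q).card) :
    s.filter p = s.filter q := by
  by_cases hpq : s.filter p ⊆ s.filter q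
  · exact Finset.eq_of_subset_of_card_le hpq h.ge
  · refine (Finset.eq_of_subset_of_card_le ?_ h.le).symm
    obtain ⟨i, hi, hi'⟩ := Finset.not_subset.1 hpq
    simp only [Finset.mem_filter, not_and] at hi hi'
    intro j hj
    rw [Finset.mem_filter] at hj ⊢
    refine ⟨hj.1, ?_⟩
    rcases lt_trichotomy i j with hij | rfl | hij
    · exact absurd (hq i hi.1 j hj.1 hij hj.2) (hi' hi.1)
    · exact hi.2
    · exact hp j hj.1 i hi.1 hij hi.2

/-- What is popped from a stack is its top part, so the sizes determine the stacks. -/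
theorem stacks_eq_of_stackSizes_eq {A B : ℕ → α} {n : ℕ}
    (h : ∀ k < n, stackSizes A k = stackSizes B k) (k : ℕ) (hk : k < n) :
    rightMaxima A k = rightMaxima B k ∧ rightMinima A k = rightMinima B k := by
  induction k with
  | zero => simp [rightMaxima, rightMinima]
  | succ k ih =>
    obtain ⟨ih1, ih2⟩ := ih (by omega)
    have hs := h (k + 1) hk
    simp only [stackSizes, Prod.mk.injEq, rightMaxima_succ, rightMinima_succ, ih1, ih2] at hs ⊢
    have hA := strictAntiOn_rightMaxima A k
    have hB := strictAntiOn_rightMaxima B k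
    have hA' := monotoneOn_rightMinima A k
    have hB' := monotoneOn_rightMinima B k
    rw [ih1] at hA
    rw [ih2] at hA'
    exact ⟨filter_eq_filter_of_card_eq _ _ _ (fun i hi j hj hij hp => hp.trans (hA hi hj hij))
      (fun i hi j hj hij hp => hp.trans (hB hi hj hij)) hs.1,
      filter_eq_filter_of_card_eq _ _ _ (fun i hi j hj hij hp => (hA' hi hj hij.le).trans hp)
      (fun i hi j hj hij hp => (hB' hi hj hij.le).trans hp) hs.2⟩

end Stacks

/-! ### Every walk comes from an array -/

/-- A value outside `T` can be chosen with any given position among the values `f i`, except below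
all of them. -/
theorem exists_card_filter_lt_eq {α ι : Type*} [LinearOrder α] [DenselyOrdered α] [NoMinOrder α]
    [NoMaxOrder α] [Nonempty α] (T : Finset α) (s : Finset ι) (f : ι → α)
    (hf : Set.InjOn f s) (j : ℕ) (hj : j < s.card) :
    ∃ v, v ∉ T ∧ (s.filter fun i => v < f i).card = j := by
  classical
  induction s using Finset.induction_on_min_value f generalizing j with
  | empty => simp at hj
  | insert a s ha hmin ih =>
    have hlt : ∀ x ∈ s, f a < f x := fun x hx => lt_of_le_of_ne (hmin x hx) fun h =>
      ha ((hf (Finset.mem_insert_self a s) (Finset.mem_insert_of_mem hx) h) ▸ hx)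
    rw [Finset.card_insert_of_notMem ha] at hj
    rcases Nat.lt_or_ge j s.card with hjs | hjs
    · obtain ⟨v, hv, hc⟩ := ih (hf.mono (by simp)) j hjs
      refine ⟨v, hv, ?_⟩
      rw [Finset.filter_insert, if_neg, hc]
      intro hva
      rw [Finset.filter_true_of_mem fun x hx => hva.trans (hlt x hx)] at hc
      omega
    · -- The new value separates `f a` from the values on `s`.
      obtain ⟨v, h1, h2⟩ := Order.exists_between_finsets
        (insert (f a) (T.filter fun t => ∀ x ∈ s, t < f x)) (s.image f) (by
          intro x hx y hy
          obtain ⟨i, hi, rfl⟩ := Finset.mem_image.1 hy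
          rcases Finset.mem_insert.1 hx with rfl | hx
          · exact hlt i hi
          · exact (Finset.mem_filter.1 hx).2 i hi)
      refine ⟨v, fun hv => ?_, ?_⟩
      · exact lt_irrefl v (h1 v (Finset.mem_insert_of_mem (Finset.mem_filter.2
          ⟨hv, fun x hx => h2 _ (Finset.mem_image_of_mem f hx)⟩)))
      · rw [Finset.filter_insert, if_neg (h1 _ (Finset.mem_insert_self _ _)).not_gt,
          Finset.filter_true_of_mem fun x hx => h2 _ (Finset.mem_image_of_mem f hx)]
        omega

theorem exists_card_filter_gt_eq {α ι : Type*} [LinearOrder α] [DenselyOrdered α] [NoMinOrder α]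
    [NoMaxOrder α] [Nonempty α] (T : Finset α) (s : Finset ι) (f : ι → α)
    (hf : Set.InjOn f s) (j : ℕ) (hj : j < s.card) :
    ∃ v, v ∉ T ∧ (s.filter fun i => f i < v).card = j := by
  obtain ⟨v, hv, hc⟩ := exists_card_filter_lt_eq (T.map OrderDual.toDual.toEmbedding) s
    (OrderDual.toDual ∘ f) (OrderDual.toDual.injective.comp_injOn hf) j hj
  exact ⟨OrderDual.ofDual v,
    fun h => hv (Finset.mem_map.2 ⟨_, h, OrderDual.toDual_ofDual v⟩), hc⟩

/-- Every step of the walk is realized by a suitable next value, different from all earlier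
ones. -/
theorem exists_update_stackSizes_eq (A : ℕ → ℝ) (k : ℕ) (hA : Set.InjOn A (Set.Iic k))
    (t : ℕ × ℕ) (ht : t ∈ nextStates (stackSizes A k)) :
    ∃ v, (∀ i ≤ k, A i ≠ v) ∧ stackSizes (Function.update A (k + 1) v) (k + 1) = t := by
  have hmax := Finset.card_insert_of_notMem (notMem_rightMaxima A k)
  have hmin := Finset.card_insert_of_notMem (notMem_rightMinima A k)
  have hle : ∀ i ∈ insert k (rightMaxima A k), i ≤ k := by
    intro i hi
    rcases Finset.mem_insert.1 hi with rfl | hi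
    · rfl
    · exact (mem_rightMaxima.1 hi).1.le
  have hle' : ∀ i ∈ insert k (rightMinima A k), i ≤ k := by
    intro i hi
    rcases Finset.mem_insert.1 hi with rfl | hi
    · rfl
    · exact (mem_rightMinima.1 hi).1.le
  have hgeA : ∀ i ∈ insert k (rightMaxima A k), A k ≤ A i := fun i hi =>
    (strictAntiOn_rightMaxima A k).antitoneOn hi (Finset.mem_insert_self _ _) (hle i hi)
  have hleA : ∀ i ∈ insert k (rightMinima A k), A i ≤ A k := fun i hi =>
    monotoneOn_rightMinima A k hi (Finset.mem_insert_self _ _) (hle' i hi)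
  have hsizes (v : ℝ) : stackSizes (Function.update A (k + 1) v) (k + 1) =
      (((insert k (rightMaxima A k)).filter fun i => v < A i).card,
        ((insert k (rightMinima A k)).filter fun i => A i ≤ v).card) := by
    have hup : ∀ i ≤ k, Function.update A (k + 1) v i = A i := fun i hi =>
      Function.update_of_ne (by omega) _ _
    rw [stackSizes, rightMaxima_succ, rightMinima_succ, rightMaxima_congr hup,
      rightMinima_congr hup, Function.update_self]
    congr 2
    · exact Finset.filter_congr fun i hi => by rw [hup i (hle i hi)]
    · exact Finset.filter_congr fun i hi => by rw [hup i (hle' i hi)]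
  have hT : ∀ v, v ∉ (Finset.range (k + 1)).image A → ∀ i ≤ k, A i ≠ v := fun v hv i hi h =>
    hv (Finset.mem_image.2 ⟨i, Finset.mem_range.2 (by omega), h⟩)
  rw [mem_nextStates] at ht
  simp only [stackSizes] at ht
  rcases ht with ⟨h1, h2⟩ | ⟨h1, h2⟩
  · obtain ⟨v, hv, hc⟩ := exists_card_filter_gt_eq ((Finset.range (k + 1)).image A)
      (insert k (rightMinima A k)) A (hA.mono hle') t.2 (by omega)
    have hv' := hT v hv
    refine ⟨v, hv', ?_⟩
    have hc' : ((insert k (rightMinima A k)).filter fun i => A i ≤ v).card = t.2 := by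
      rw [← hc]
      congr 1
      exact Finset.filter_congr fun i hi => (hv' i (hle' i hi)).le_iff_lt
    have hvk : v < A k := by
      by_contra hvk
      rw [Finset.filter_true_of_mem fun i hi => (hleA i hi).trans (not_lt.1 hvk)] at hc'
      omega
    rw [hsizes, hc', Finset.filter_true_of_mem fun i hi => hvk.trans_le (hgeA i hi), hmax, ← h1]
  · obtain ⟨v, hv, hc⟩ := exists_card_filter_lt_eq ((Finset.range (k + 1)).image A)
      (insert k (rightMaxima A k)) A (hA.mono hle) t.1 (by omega)
    have hv' := hT v hv
    refine ⟨v, hv', ?_⟩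
    have hvk : A k ≤ v := by
      by_contra hvk
      rw [Finset.filter_true_of_mem fun i hi => (not_le.1 hvk).trans_le (hgeA i hi)] at hc
      omega
    rw [hsizes, hc, Finset.filter_true_of_mem fun i hi => (hleA i hi).trans hvk, hmin, ← h2]

theorem exists_array_extending (m k : ℕ) (A : ℕ → ℝ) (hA : Set.InjOn A (Set.Iic k))
    (p : List (ℕ × ℕ)) (hp : p ∈ walks m (stackSizes A k)) :
    ∃ B : ℕ → ℝ, (∀ i ≤ k, B i = A i) ∧ Set.InjOn B (Set.Iic (k + m)) ∧
      (List.range' (k + 1) m).map (stackSizes B) = p := by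
  induction m generalizing k A p with
  | zero => exact ⟨A, fun _ _ => rfl, hA, by simpa [walks, eq_comm] using hp⟩
  | succ m ih =>
    rw [walks, Finset.mem_biUnion] at hp
    obtain ⟨t, ht, hp⟩ := hp
    obtain ⟨q, hq, rfl⟩ := Finset.mem_image.1 hp
    obtain ⟨v, hv, hvt⟩ := exists_update_stackSizes_eq A k hA t ht
    have hup : ∀ i ≤ k, Function.update A (k + 1) v i = A i := fun i hi =>
      Function.update_of_ne (by omega) _ _
    obtain ⟨B, hB, hinj, hmap⟩ := ih (k + 1) (Function.update A (k + 1) v) (by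
      intro i hi j hj hij
      simp only [Set.mem_Iic] at hi hj
      rcases Nat.le_succ_iff.1 hi with hi | rfl <;> rcases Nat.le_succ_iff.1 hj with hj | rfl
      · rw [hup i hi, hup j hj] at hij
        exact hA hi hj hij
      · rw [hup i hi, Function.update_self] at hij
        exact absurd hij (hv i hi)
      · rw [hup j hj, Function.update_self] at hij
        exact absurd hij.symm (hv j hj)
      · rfl) q (by rwa [hvt])
    refine ⟨B, fun i hi => (hB i (by omega)).trans (hup i hi), ?_, ?_⟩
    · rwa [show k + (m + 1) = k + 1 + m by ring]
    · rw [List.range'_succ, List.map_cons, hmap, stackSizes_congr hB, hvt]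

/-! ### Queries and stacks -/

/-- An array of length `n`, continued by zeros. Stacks at times before `n` do not see the
continuation. -/
noncomputable def extendByZero {n : ℕ} (A : Fin n → ℝ) (i : ℕ) : ℝ :=
  if h : i < n then A ⟨i, h⟩ else 0

theorem extendByZero_val {n : ℕ} (A : Fin n → ℝ) (i : Fin n) : extendByZero A i = A i := by
  simp [extendByZero]

/-- `l` is the last position of a maximum of `A` over `[i, j]`. -/
def IsLastMax (A : ℕ → ℝ) (i j l : ℕ) : Prop :=
  i ≤ l ∧ l ≤ j ∧ (∀ k, i ≤ k → k ≤ j → A k ≤ A l) ∧ ∀ k, l < k → k ≤ j → A k < A l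

/-- `l` is the first position of a minimum of `A` over `[i, j]`. -/
def IsFirstMin (A : ℕ → ℝ) (i j l : ℕ) : Prop :=
  i ≤ l ∧ l ≤ j ∧ (∀ k, i ≤ k → k < l → A l < A k) ∧ ∀ k, l < k → k ≤ j → A l ≤ A k

theorem exists_isLastMax (A : ℕ → ℝ) {i j : ℕ} (hij : i ≤ j) : ∃ l, IsLastMax A i j l := by
  induction j, hij using Nat.le_induction with
  | base =>
    exact ⟨i, le_rfl, le_rfl, fun k h1 h2 => by rw [le_antisymm h2 h1], fun k h1 h2 => by omega⟩
  | succ j hij ih =>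
    obtain ⟨l, h1, h2, h3, h4⟩ := ih
    rcases lt_or_ge (A (j + 1)) (A l) with h | h
    · refine ⟨l, h1, by omega, fun k hk hk' => ?_, fun k hk hk' => ?_⟩
      · rcases Nat.le_succ_iff.1 hk' with hk' | rfl
        · exact h3 k hk hk'
        · exact h.le
      · rcases Nat.le_succ_iff.1 hk' with hk' | rfl
        · exact h4 k hk hk'
        · exact h
    · refine ⟨j + 1, by omega, le_rfl, fun k hk hk' => ?_, fun k hk hk' => by omega⟩
      rcases Nat.le_succ_iff.1 hk' with hk' | rfl
      · exact (h3 k hk hk').trans h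
      · rfl

theorem exists_isFirstMin (A : ℕ → ℝ) {i j : ℕ} (hij : i ≤ j) : ∃ l, IsFirstMin A i j l := by
  induction j, hij using Nat.le_induction with
  | base => exact ⟨i, le_rfl, le_rfl, fun k h1 h2 => by omega, fun k h1 h2 => by omega⟩
  | succ j hij ih =>
    obtain ⟨l, h1, h2, h3, h4⟩ := ih
    rcases le_or_gt (A l) (A (j + 1)) with h | h
    · refine ⟨l, h1, by omega, h3, fun k hk hk' => ?_⟩
      rcases Nat.le_succ_iff.1 hk' with hk' | rfl
      · exact h4 k hk hk'
      · exact h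
    · refine ⟨j + 1, by omega, le_rfl, fun k hk hk' => ?_, fun k hk hk' => by omega⟩
      rcases lt_trichotomy k l with hkl | rfl | hkl
      · exact h.trans (h3 k hk hkl)
      · exact h
      · exact h.trans_le (h4 k hkl (by omega))

/-- The last maximum over `[i, j]` is `j`, or a position on the stack at time `j`, and the first
one from `i` on; hence it depends on the stack only. -/
theorem IsLastMax.eq_of_rightMaxima_eq {A B : ℕ → ℝ} {i j p q : ℕ} (hp : IsLastMax A i j p)
    (hq : IsLastMax B i j q) (h : rightMaxima A j = rightMaxima B j) : p = q := by
  obtain ⟨h1, h2, h3, h4⟩ := hp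
  obtain ⟨g1, g2, g3, g4⟩ := hq
  rcases lt_trichotomy p q with hpq | hpq | hpq
  · have hp : p ∈ rightMaxima A j := mem_rightMaxima.2 ⟨by omega, h4⟩
    rw [h] at hp
    exact absurd ((mem_rightMaxima.1 hp).2 q hpq g2) (g3 p h1 h2).not_gt
  · exact hpq
  · have hq : q ∈ rightMaxima B j := mem_rightMaxima.2 ⟨by omega, g4⟩
    rw [← h] at hq
    exact absurd ((mem_rightMaxima.1 hq).2 p hpq h2) (h3 q g1 g2).not_gt

theorem IsFirstMin.eq_of_rightMinima_eq {A B : ℕ → ℝ} {i j p q : ℕ} (hp : IsFirstMin A i j p)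
    (hq : IsFirstMin B i j q) (h : rightMinima A j = rightMinima B j) : p = q := by
  obtain ⟨h1, h2, h3, h4⟩ := hp
  obtain ⟨g1, g2, g3, g4⟩ := hq
  rcases lt_trichotomy p q with hpq | hpq | hpq
  · have hp : p ∈ rightMinima A j := mem_rightMinima.2 ⟨by omega, h4⟩
    rw [h] at hp
    exact absurd ((mem_rightMinima.1 hp).2 q hpq g2) (g3 p h1 hpq).not_ge
  · exact hpq
  · have hq : q ∈ rightMinima B j := mem_rightMinima.2 ⟨by omega, g4⟩
    rw [← h] at hq
    exact absurd ((mem_rightMinima.1 hq).2 p hpq h2) (h3 q g1 hpq).not_ge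

theorem IsLastMax.isRangeMax {n : ℕ} {A : Fin n → ℝ} {i j l : Fin n}
    (h : IsLastMax (extendByZero A) i j l) : IsRangeMax A i j l := by
  obtain ⟨h1, h2, h3, -⟩ := h
  refine ⟨⟨h1, h2⟩, isMaxOn_iff.2 fun k hk => ?_⟩
  simpa only [extendByZero_val] using h3 k hk.1 hk.2

theorem IsFirstMin.isRangeMin {n : ℕ} {A : Fin n → ℝ} {i j l : Fin n}
    (h : IsFirstMin (extendByZero A) i j l) : IsRangeMin A i j l := by
  obtain ⟨h1, h2, h3, h4⟩ := h
  refine ⟨⟨h1, h2⟩, isMinOn_iff.2 fun k hk => ?_⟩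
  rcases lt_trichotomy k l with hkl | rfl | hkl
  · simpa only [extendByZero_val] using (h3 k hk.1 hkl).le
  · rfl
  · simpa only [extendByZero_val] using h4 k hkl hk.2

/-- For an array with distinct values, a position is on a stack at time `k` exactly if it is the
answer to the query from it to `k`. -/
theorem mem_rightMaxima_iff_of_answers {n : ℕ} {A : Fin n → ℝ} (hA : Function.Injective A)
    {q : Fin n → Fin n → Fin n} (hq : ∀ i j, i ≤ j → IsRangeMax A i j (q i j)) (i k : Fin n) :
    (i : ℕ) ∈ rightMaxima (extendByZero A) k ↔ i < k ∧ q i k = i := by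
  rw [mem_rightMaxima, Fin.val_fin_lt]
  refine and_congr_right fun hik => ⟨fun h => ?_, fun h j hij hjk => ?_⟩
  · obtain ⟨⟨h1, h2⟩, h3⟩ := hq i k hik.le
    by_contra hne
    have hlt := h (q i k) (lt_of_le_of_ne h1 (Fin.val_ne_of_ne (Ne.symm hne))) h2
    rw [extendByZero_val, extendByZero_val] at hlt
    exact (h3 ⟨le_rfl, hik.le⟩).not_gt hlt
  · lift j to Fin n using hjk.trans_lt k.2
    rw [extendByZero_val, extendByZero_val]
    have h3 := (hq i k hik.le).2 (show j ∈ Set.Icc i k from ⟨le_of_lt hij, hjk⟩)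
    rw [h] at h3
    refine lt_of_le_of_ne h3 fun heq => ?_
    have := hA heq
    subst this
    exact lt_irrefl _ hij

theorem mem_rightMinima_iff_of_answers {n : ℕ} {A : Fin n → ℝ} (hA : Function.Injective A)
    {q : Fin n → Fin n → Fin n} (hq : ∀ i j, i ≤ j → IsRangeMin A i j (q i j)) (i k : Fin n) :
    (i : ℕ) ∈ rightMinima (extendByZero A) k ↔ i < k ∧ q i k = i := by
  rw [mem_rightMinima, Fin.val_fin_lt]
  refine and_congr_right fun hik => ⟨fun h => ?_, fun h j hij hjk => ?_⟩
  · obtain ⟨⟨h1, h2⟩, h3⟩ := hq i k hik.le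
    by_contra hne
    have hle := h (q i k) (lt_of_le_of_ne h1 (Fin.val_ne_of_ne (Ne.symm hne))) h2
    rw [extendByZero_val, extendByZero_val] at hle
    exact hne (hA (le_antisymm (h3 ⟨le_rfl, hik.le⟩) hle))
  · lift j to Fin n using hjk.trans_lt k.2
    rw [extendByZero_val, extendByZero_val]
    have h3 := (hq i k hik.le).2 (show j ∈ Set.Icc i k from ⟨le_of_lt hij, hjk⟩)
    rwa [h] at h3

/-- The answers to all queries determine the walk of an array with distinct values. -/
theorem stackSizes_eq_of_answers {n : ℕ} {A B : Fin n → ℝ} (hA : Function.Injective A)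
    (hB : Function.Injective B) (q : Fin n → Fin n → Fin n × Fin n)
    (hqA : ∀ i j, i ≤ j → IsRangeMax A i j (q i j).1 ∧ IsRangeMin A i j (q i j).2)
    (hqB : ∀ i j, i ≤ j → IsRangeMax B i j (q i j).1 ∧ IsRangeMin B i j (q i j).2)
    (k : ℕ) (hk : k < n) :
    stackSizes (extendByZero A) k = stackSizes (extendByZero B) k := by
  lift k to Fin n using hk
  have h1 : rightMaxima (extendByZero A) k = rightMaxima (extendByZero B) k := by
    ext i
    by_cases hi : i < n
    · lift i to Fin n using hi
      rw [mem_rightMaxima_iff_of_answers hA (fun i j h => (hqA i j h).1),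
        mem_rightMaxima_iff_of_answers hB (fun i j h => (hqB i j h).1)]
    · simp only [mem_rightMaxima]
      omega
  have h2 : rightMinima (extendByZero A) k = rightMinima (extendByZero B) k := by
    ext i
    by_cases hi : i < n
    · lift i to Fin n using hi
      rw [mem_rightMinima_iff_of_answers hA (fun i j h => (hqA i j h).2),
        mem_rightMinima_iff_of_answers hB (fun i j h => (hqB i j h).2)]
    · simp only [mem_rightMinima]
      omega
  rw [stackSizes, stackSizes, h1, h2]

/-- Only the order of the values matters, so they may be replaced by their ranks. -/
theorem exists_permArray_of_injOn {n : ℕ} (B : ℕ → ℝ) (hB : Set.InjOn B (Set.Iio n)) :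
    ∃ A ∈ permArrays n, ∀ k < n, stackSizes (extendByZero A) k = stackSizes B k := by
  let rank : Fin n → Fin n := fun i =>
    ⟨(Finset.univ.filter fun j : Fin n => B j < B i).card, by
      refine (Finset.card_lt_card (Finset.filter_ssubset.2 ⟨i, Finset.mem_univ i, ?_⟩)).trans_eq
        (Finset.card_fin n)
      exact lt_irrefl _⟩
  have hlt (i j : Fin n) (h : B i < B j) : rank i < rank j := by
    have hss : (Finset.univ.filter fun k : Fin n => B k < B i) ⊂
        Finset.univ.filter fun k : Fin n => B k < B j := by
      refine (Finset.ssubset_iff_of_subset fun k hk => ?_).2 ⟨i, ?_, ?_⟩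
      · rw [Finset.mem_filter] at hk ⊢
        exact ⟨hk.1, hk.2.trans h⟩
      · simpa using h
      · simp
    exact Finset.card_lt_card hss
  have hinj : Function.Injective rank := by
    intro i j hij
    rcases lt_trichotomy (B i) (B j) with h | h | h
    · exact absurd hij (hlt i j h).ne
    · exact Fin.ext (hB i.2 j.2 h)
    · exact absurd hij (hlt j i h).ne'
  have hiff (i j : Fin n) : rank i < rank j ↔ B i < B j := by
    refine ⟨fun h => ?_, hlt i j⟩
    by_contra hn
    rcases (not_lt.1 hn).eq_or_lt with h' | h'
    · exact h.ne' (congrArg rank (Fin.ext (hB j.2 i.2 h')))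
    · exact (hlt j i h').not_gt h
  let σ : Equiv.Perm (Fin n) := Equiv.ofBijective rank (Finite.injective_iff_bijective.1 hinj)
  let A : Fin n → ℝ := fun k => ((σ k : ℕ) : ℝ) + 1
  have hA (i j : ℕ) (hi : i < n) (hj : j < n) :
      extendByZero A i < extendByZero A j ↔ B i < B j := by
    lift i to Fin n using hi
    lift j to Fin n using hj
    rw [extendByZero_val, extendByZero_val, ← hiff]
    simp only [A, add_lt_add_iff_right, Nat.cast_lt, Fin.val_fin_lt]
    rfl
  refine ⟨A, ⟨σ, fun _ => rfl⟩, fun k hk => ?_⟩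
  have h1 : rightMaxima (extendByZero A) k = rightMaxima B k := by
    ext i
    simp only [mem_rightMaxima]
    refine and_congr_right fun hi => forall_congr' fun j => forall_congr' fun _ => forall_congr'
      fun hj => hA j i (by omega) (by omega)
  have h2 : rightMinima (extendByZero A) k = rightMinima B k := by
    ext i
    simp only [mem_rightMinima]
    refine and_congr_right fun hi => forall_congr' fun j => forall_congr' fun _ => forall_congr'
      fun hj => ?_
    rw [← not_lt, hA j i (by omega) (by omega), not_lt]
  rw [stackSizes, stackSizes, h1, h2]

theorem injective_of_mem_permArrays {n : ℕ} {A : Fin n → ℝ} (hA : A ∈ permArrays n) :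
    Function.Injective A := by
  obtain ⟨σ, hσ⟩ := hA
  intro i j h
  rw [hσ, hσ] at h
  exact σ.injective (Fin.ext (by exact_mod_cast add_right_cancel h))

/-! ### From walks to encodings -/

/-- The walk of an array: the stack sizes after the first position. -/
noncomputable def arrayWalk {n : ℕ} (A : Fin n → ℝ) : List (ℕ × ℕ) :=
  (List.range' 1 (n - 1)).map (stackSizes (extendByZero A))

theorem arrayWalk_mem {n : ℕ} (A : Fin n → ℝ) : arrayWalk A ∈ walks (n - 1) (0, 0) := by
  rw [← stackSizes_zero (extendByZero A)]
  exact map_stackSizes_mem_walks _ 0 _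

theorem map_stackSizes_eq_iff {A B : ℕ → ℝ} {n : ℕ} :
    (List.range' 1 (n - 1)).map (stackSizes A) = (List.range' 1 (n - 1)).map (stackSizes B) ↔
      ∀ k < n, stackSizes A k = stackSizes B k := by
  rw [List.map_inj_left]
  constructor
  · intro h k hk
    rcases k.eq_zero_or_pos with rfl | h0
    · rw [stackSizes_zero, stackSizes_zero]
    · exact h k (List.mem_range'_1.2 (by omega))
  · intro h k hk
    have := List.mem_range'_1.1 hk
    exact h k (by omega)

theorem exists_permArray_arrayWalk_eq {n : ℕ} (hn : 0 < n) {p : List (ℕ × ℕ)}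
    (hp : p ∈ walks (n - 1) (0, 0)) : ∃ A ∈ permArrays n, arrayWalk A = p := by
  rw [← stackSizes_zero (fun _ => (0 : ℝ))] at hp
  obtain ⟨B, -, hB, rfl⟩ := exists_array_extending (n - 1) 0 (fun _ => (0 : ℝ))
    (fun i hi j hj _ => (Nat.le_zero.1 hi).trans (Nat.le_zero.1 hj).symm) p hp
  obtain ⟨A, hA, h⟩ := exists_permArray_of_injOn (n := n) B (hB.mono fun i hi => by
    simp only [Set.mem_Iio, Set.mem_Iic] at hi ⊢
    omega)
  exact ⟨A, hA, map_stackSizes_eq_iff.2 h⟩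

/-- The bit string stored for an array is a code of its walk, so `m` bits suffice as soon as there
are at most `2 ^ m` walks. -/
theorem nonempty_rangeMinMaxEncoding {n m : ℕ} (h : (walks (n - 1) (0, 0)).card ≤ 2 ^ m) :
    Nonempty (RangeMinMaxEncoding n Set.univ m) := by
  classical
  obtain ⟨e⟩ : Nonempty (walks (n - 1) (0, 0) ↪ (Fin m → Bool)) :=
    Function.Embedding.nonempty_of_card_le (by simpa using h)
  let enc : (Fin n → ℝ) → List Bool := fun A => List.ofFn (e ⟨arrayWalk A, arrayWalk_mem A⟩)
  have henc {A B : Fin n → ℝ} (hAB : enc A = enc B) : arrayWalk A = arrayWalk B :=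
    congrArg Subtype.val (e.injective (List.ofFn_injective hAB))
  -- The last maximum and the first minimum over `[i, j]` are the same for all arrays with the
  -- given bit string.
  have hex (s : List Bool) (i j : Fin n) : ∃ r : Fin n × Fin n, ∀ A, enc A = s → i ≤ j →
      IsRangeMax A i j r.1 ∧ IsRangeMin A i j r.2 := by
    by_cases hs : ∃ B, enc B = s ∧ i ≤ j
    · obtain ⟨B, rfl, hij⟩ := hs
      obtain ⟨p, hp⟩ := exists_isLastMax (extendByZero B) (i := i) hij
      obtain ⟨q, hq⟩ := exists_isFirstMin (extendByZero B) (i := i) hij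
      lift p to Fin n using hp.2.1.trans_lt j.2
      lift q to Fin n using hq.2.1.trans_lt j.2
      refine ⟨(p, q), fun A hA _ => ?_⟩
      obtain ⟨hmax, hmin⟩ :=
        stacks_eq_of_stackSizes_eq (map_stackSizes_eq_iff.1 (henc hA)) j j.2
      obtain ⟨p', hp'⟩ := exists_isLastMax (extendByZero A) (i := i) hij
      obtain ⟨q', hq'⟩ := exists_isFirstMin (extendByZero A) (i := i) hij
      rw [hp'.eq_of_rightMaxima_eq hp hmax] at hp'
      rw [hq'.eq_of_rightMinima_eq hq hmin] at hq'
      exact ⟨hp'.isRangeMax, hq'.isRangeMin⟩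
    · exact ⟨(i, i), fun A hA hij => absurd ⟨A, hA, hij⟩ hs⟩
  choose query hquery using hex
  exact ⟨enc, query, fun A _ => by simp [enc], fun A _ i j hij => hquery _ i j A rfl hij⟩

theorem card_lists_length_le (m : ℕ) (S : Finset (List Bool)) (hS : ∀ l ∈ S, l.length ≤ m) :
    S.card < 2 ^ (m + 1) := by
  classical
  have hsub : S ⊆ (Finset.range (m + 1)).biUnion fun i =>
      (Finset.univ : Finset (List.Vector Bool i)).image List.Vector.toList := by
    intro l hl
    rw [Finset.mem_biUnion]
    exact ⟨l.length, Finset.mem_range.2 (Nat.lt_succ_of_le (hS l hl)),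
      Finset.mem_image.2 ⟨⟨l, rfl⟩, Finset.mem_univ _, rfl⟩⟩
  calc S.card ≤ _ := Finset.card_le_card hsub
    _ ≤ ∑ i ∈ Finset.range (m + 1), 2 ^ i := by
      refine Finset.card_biUnion_le.trans (Finset.sum_le_sum fun i _ => ?_)
      exact Finset.card_image_le.trans_eq (by simp [card_vector])
    _ < 2 ^ (m + 1) := Nat.geomSum_lt le_rfl fun i hi => Finset.mem_range.1 hi

/-- Every walk is the walk of a permutation, and permutations with different walks need different
bit strings. -/
theorem card_walks_lt_of_encoding {n m : ℕ} (hn : 0 < n) {𝒜 : Set (Fin n → ℝ)}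
    (h𝒜 : permArrays n ⊆ 𝒜) (E : RangeMinMaxEncoding n 𝒜 m) :
    (walks (n - 1) (0, 0)).card < 2 ^ (m + 1) := by
  classical
  choose! arr harr hwalk using fun p (hp : p ∈ walks (n - 1) (0, 0)) =>
    exists_permArray_arrayWalk_eq hn hp
  have hinj : Set.InjOn (fun p => E.encode (arr p)) (walks (n - 1) (0, 0)) := by
    intro p hp q hq hpq
    rw [← hwalk p hp, ← hwalk q hq]
    refine map_stackSizes_eq_iff.2 fun k hk => stackSizes_eq_of_answers
      (injective_of_mem_permArrays (harr p hp)) (injective_of_mem_permArrays (harr q hq))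
      (E.query (E.encode (arr p))) (E.correct _ (h𝒜 (harr p hp))) ?_ k hk
    have hpq' : E.encode (arr p) = E.encode (arr q) := hpq
    rw [hpq']
    exact E.correct _ (h𝒜 (harr q hq))
  rw [← Finset.card_image_of_injOn hinj]
  refine card_lists_length_le m _ fun l hl => ?_
  obtain ⟨p, hp, rfl⟩ := Finset.mem_image.1 hl
  exact E.length_le _ (h𝒜 (harr p hp))

theorem le_length_of_encoding {n m : ℕ} (hn : 4 ≤ n) {𝒜 : Set (Fin n → ℝ)}
    (h𝒜 : permArrays n ⊆ 𝒜) (E : RangeMinMaxEncoding n 𝒜 m) :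
    3 * (n : ℝ) - 15 * Real.logb 2 n ≤ m := by
  have hlt : 8 ^ (n - 2) ≤ n ^ 8 * 2 ^ (m + 1) :=
    (eight_pow_le_mul_card_walks hn).trans
      (Nat.mul_le_mul_left _ (card_walks_lt_of_encoding (by omega) h𝒜 E).le)
  have hn0 : (n : ℝ) ≠ 0 := by
    have : n ≠ 0 := by omega
    exact_mod_cast this
  have hreal : (2 : ℝ) ^ (3 * (n - 2)) ≤ (n : ℝ) ^ 8 * 2 ^ (m + 1) := by
    rw [pow_mul]
    norm_num
    exact_mod_cast hlt
  have hlog := Real.logb_le_logb_of_le one_lt_two (by positivity) hreal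
  rw [Real.logb_mul (by positivity) (by positivity), Real.logb_pow, Real.logb_pow, Real.logb_pow,
    Real.logb_self_eq_one one_lt_two] at hlog
  have hn2 : ((n - 2 : ℕ) : ℝ) = n - 2 := by
    rw [Nat.cast_sub (by omega)]
    norm_num
  have h1 : 1 ≤ Real.logb 2 n := by
    rw [Real.le_logb_iff_rpow_le one_lt_two (by positivity)]
    have : 2 ≤ n := by omega
    simpa using (by exact_mod_cast this : (2 : ℝ) ≤ n)
  push_cast [hn2] at hlog
  linarith

theorem exists_short_encoding {n : ℕ} (hn : 0 < n) :
    ∃ m : ℕ, Nonempty (RangeMinMaxEncoding n Set.univ m) ∧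
      (m : ℝ) ≤ 3 * (n : ℝ) - 1 / 2 * Real.logb 2 n := by
  set c := (walks (n - 1) (0, 0)).card
  refine ⟨Nat.clog 2 c, nonempty_rangeMinMaxEncoding (Nat.le_pow_clog one_lt_two _), ?_⟩
  have hcpos : 0 < c := Finset.card_pos.2 ⟨_, arrayWalk_mem fun _ : Fin n => (0 : ℝ)⟩
  have hpow : 2 ^ Nat.clog 2 c ≤ 2 * c := by
    rcases Nat.lt_or_ge 1 c with h | h
    · have := Nat.pow_pred_clog_lt_self one_lt_two h
      have hpos := Nat.clog_pos one_lt_two h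
      rw [← Nat.succ_pred_eq_of_pos hpos, pow_succ]
      omega
    · rw [Nat.clog_of_right_le_one h]
      omega
  have hnat : 2 ^ (2 * Nat.clog 2 c) * n ≤ 2 ^ (6 * n) := by
    calc 2 ^ (2 * Nat.clog 2 c) * n = (2 ^ Nat.clog 2 c) ^ 2 * n := by
          rw [← pow_mul, mul_comm 2]
      _ ≤ (2 * c) ^ 2 * (2 * (n - 1) + 1) := by
        gcongr
        omega
      _ = 4 * (c ^ 2 * (2 * (n - 1) + 1)) := by ring
      _ ≤ 64 * 64 ^ (n - 1) := Nat.mul_le_mul (by norm_num) (card_walks_sq_mul_le _)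
      _ = 2 ^ (6 * n) := by
        rw [← pow_succ', Nat.sub_add_cancel hn, pow_mul]
        norm_num
  have hreal : (2 : ℝ) ^ (2 * Nat.clog 2 c) * n ≤ 2 ^ (6 * n) := mod_cast hnat
  have hn0 : (0 : ℝ) < n := mod_cast hn
  have hlog := Real.logb_le_logb_of_le one_lt_two (by positivity) hreal
  rw [Real.logb_mul (by positivity) (by positivity), Real.logb_pow, Real.logb_pow,
    Real.logb_self_eq_one one_lt_two] at hlog
  push_cast at hlog
  linarith

/-- Any encoding of range minimum and maximum queries must occupy `3n - Θ(log n)` bits: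
the least sufficient number of bits lies between `3n - C log₂ n` and `3n - c log₂ n`.
The lower bound already holds if the encoding need only handle permutations (or any larger class
of arrays), and the matching bound is attained by encodings that handle all arrays. -/
theorem mainTheorem3 :
    ∃ c C : ℝ, 0 < c ∧ 0 < C ∧ ∃ N : ℕ, ∀ n : ℕ, N ≤ n →
      (∀ (𝒜 : Set (Fin n → ℝ)), permArrays n ⊆ 𝒜 →
        ∀ m : ℕ, Nonempty (RangeMinMaxEncoding n 𝒜 m) →
          3 * (n : ℝ) - C * Real.logb 2 (n : ℝ) ≤ (m : ℝ)) ∧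
      (∃ m : ℕ, Nonempty (RangeMinMaxEncoding n Set.univ m) ∧
        (m : ℝ) ≤ 3 * (n : ℝ) - c * Real.logb 2 (n : ℝ)) :=
  ⟨1 / 2, 15, by norm_num, by norm_num, 4, fun _ hn =>
    ⟨fun _ h𝒜 _ ⟨E⟩ => le_length_of_encoding hn h𝒜 E, exists_short_encoding (by omega)⟩⟩
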